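/- Conventions. For a measurable space $X$ let $\mathcal{M}(X)$ be the finite signed measures on $X$, $\mathcal{M}_1(X)\subseteq\mathcal{M}(X)$ the probability measures, and $\mathcal{M}_0(X)=\{\mu\in\mathcal{M}(X) : \mu(X)=0\}$. A kernel on $X$ is a symmetric function $k:X\times X\to\mathbb{R}$ with $\sum_{i,j=1}^n c_ic_jk(x_i,x_j)\ge 0$ for all $n$, $x_i\in X$, $c_i\in\mathbb{R}$; $H_k$ denotes its reproducing kernel Hilbert space. For measurable $k$ let $\mathcal{M}^k(X)$ be the set of $\mu\in\mathcal{M}(X)$ such that every $f\in H_k$ is measurable and $|\mu|$-integrable; for such $\mu$ the kernel mean embedding $\Phi_k(\mu)=\int k(\cdot,x)\,\mathrm{d}\mu(x)\in H_k$ is the Pettis integral, i.e. the unique element with $\langle f,\Phi_k(\mu)\rangle_{H_k}=\int f\,\mathrm{d}\mu$ for all $f\in H_k$. A measurable kernel $k$ is called characteristic if $\Phi_k$ is injective on $\mathcal{M}_1(X)\cap\mathcal{M}^k(X)$, and strictly integrally positive definite with respect to $\mathcal{M}\subseteq\mathcal{M}^k(X)$ if $\|\Phi_k(\mu)\|_{H_k}^2>0$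 for every $\mu\in\mathcal{M}\setminus\{0\}$. Let $\Phi_\infty^+$ be the class of functions $\varphi:[0,\infty)\to\mathbb{R}$ of the form $\varphi(t)=\int_{[0,\infty)}e^{-xt}\,\mathrm{d}\nu(x)$, where $\nu$ is a finite Borel measure on $[0,\infty)$ with $\nu\neq 0$ and $\operatorname{supp}\nu\neq\{0\}$. Statement. Let $\lambda$ be a $\sigma$-finite measure on a measurable space and let $1<p\le 2$ be such that the real space $L^p(\lambda)$ is separable; equip $L^p(\lambda)$ with its Borel $\sigma$-algebra. Let $\varphi\in\Phi_\infty^+$. Then \[ k(f,g):=\varphi(\|f-g\|_{L^p}),\qquad f,g\in L^p(\lambda), \] is a measurable kernel on $L^p(\lambda)$ that is characteristic, and $\mathcal{M}_0(L^p(\lambda))\subseteq\mathcal{M}^k(L^p(\lambda))$ and $k$ is strictly integrally positive definite with respect to $\mathcal{M}_0(L^p(\lambda))$. -/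

import Mathlib

open MeasureTheory
open scoped NNReal ENNReal RealInnerProductSpace

noncomputable section

namespace KernelEmbedding

universe u v

section Kernels

variable {X : Type u}

/-- A (real) kernel on `X`: a symmetric, positive definite function `k : X × X → ℝ`. -/
structure IsKernel (k : X → X → ℝ) : Prop where
  symm : ∀ x y, k x y = k y x
  posDef : ∀ (n : ℕ) (x : Fin n → X) (c : Fin n → ℝ),
    0 ≤ ∑ i, ∑ j, c i * c j * k (x i) (x j)

/-- The kernel `k` as an operator-valued matrix, the format of Mathlib's `RKHS`: the entry at
`(x, y)` is multiplication by `k x y` on `ℝ`. -/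
def kernelMatrix (k : X → X → ℝ) : Matrix X X (ℝ →L[ℝ] ℝ) :=
  Matrix.of fun x y => k x y • ContinuousLinearMap.id ℝ ℝ

theorem kernelMatrix_apply (k : X → X → ℝ) (x y : X) (a : ℝ) :
    kernelMatrix k x y a = k x y * a := by
  simp [kernelMatrix]

theorem IsKernel.posSemidef {k : X → X → ℝ} (hk : IsKernel k) :
    (kernelMatrix k).PosSemidef := by
  have key := (RKHS.posSemidef_tfae (K := kernelMatrix k)).out 0 2
  refine key.mpr ⟨?_, fun c => ?_⟩
  · ext x y
    rw [Matrix.conjTranspose_apply, ContinuousLinearMap.star_eq_adjoint]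
    refine ext_inner_right ℝ fun w => ?_
    rw [ContinuousLinearMap.adjoint_inner_left, kernelMatrix_apply, kernelMatrix_apply,
      hk.symm x y]
    simp [mul_comm]
  · have h := hk.posDef c.support.card (fun i => (c.support.equivFin.symm i : X))
      (fun i => c (c.support.equivFin.symm i : X))
    have e : ∀ f : X → ℝ, ∑ i : Fin c.support.card, f (c.support.equivFin.symm i : X)
        = ∑ x ∈ c.support, f x := fun f => by
      rw [← Finset.sum_coe_sort c.support f]
      exact Equiv.sum_comp c.support.equivFin.symm (fun x : c.support => f x)
    have h' : 0 ≤ ∑ x ∈ c.support, ∑ y ∈ c.support, c x * c y * k x y := by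
      rw [← e fun x => ∑ y ∈ c.support, c x * c y * k x y]
      refine h.trans_eq (Finset.sum_congr rfl fun i _ => ?_)
      exact e fun y => c (c.support.equivFin.symm i : X) * c y * k (c.support.equivFin.symm i : X) y
    refine h'.trans (le_of_eq ?_)
    rw [RCLike.re_to_real]
    refine Finset.sum_congr rfl fun x _ => Finset.sum_congr rfl fun y _ => ?_
    change _ = ⟪(kernelMatrix k y x) (c x), c y⟫
    rw [kernelMatrix_apply, hk.symm x y, Real.inner_apply]
    ring

/-- The reproducing kernel Hilbert space `H_k` of a kernel `k` (Moore–Aronszajn). Its elements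
coerce to functions `X → ℝ`. -/
abbrev IsKernel.Space {k : X → X → ℝ} (hk : IsKernel k) : Type u :=
  haveI : Fact (kernelMatrix k).PosSemidef := ⟨hk.posSemidef⟩
  RKHS.OfKernel (kernelMatrix k)

instance {k : X → X → ℝ} (hk : IsKernel k) : RKHS ℝ hk.Space X ℝ :=
  haveI : Fact (kernelMatrix k).PosSemidef := ⟨hk.posSemidef⟩
  RKHS.OfKernel.instRKHS

/-- The canonical feature map `x ↦ k(·, x) ∈ H_k`. -/
def IsKernel.featureMap {k : X → X → ℝ} (hk : IsKernel k) (x : X) : hk.Space :=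
  RKHS.kerFun hk.Space x (1 : ℝ)

theorem IsKernel.featureMap_apply {k : X → X → ℝ} (hk : IsKernel k) (x y : X) :
    hk.featureMap x y = k y x := by
  have : Fact (kernelMatrix k).PosSemidef := ⟨hk.posSemidef⟩
  have h : RKHS.kernel hk.Space = kernelMatrix k := RKHS.OfKernel.kernel_ofKernel
  rw [IsKernel.featureMap, RKHS.kerFun_apply, h]
  simp [kernelMatrix]

/-- The reproducing property of `H_k`. -/
theorem IsKernel.inner_featureMap {k : X → X → ℝ} (hk : IsKernel k) (f : hk.Space) (x : X) :
    ⟪f, hk.featureMap x⟫ = f x := by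
  rw [IsKernel.featureMap, RKHS.inner_kerFun]
  simp

end Kernels

section Embedding

variable {X : Type u} [MeasurableSpace X]

/-- `ℒ₁(μ)`: the measurable functions that are integrable with respect to (the total variation
of) the finite signed measure `μ`. -/
def signedL1 (μ : SignedMeasure X) : Set (X → ℝ) :=
  {f | Measurable f ∧ Integrable f μ.totalVariation}

/-- `m` is the Pettis integral of `Φ : X → H` with respect to the finite signed measure `μ`. -/
def IsPettisIntegral {H : Type v} [NormedAddCommGroup H] [InnerProductSpace ℝ H]
    (μ : SignedMeasure X) (Φ : X → H) (m : H) : Prop :=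
  ∀ w : H, (fun x => ⟪w, Φ x⟫) ∈ signedL1 μ ∧ ⟪w, m⟫ = ∫ᵛ x, ⟪w, Φ x⟫ ∂<•μ

theorem IsPettisIntegral.unique {H : Type v} [NormedAddCommGroup H] [InnerProductSpace ℝ H]
    {μ : SignedMeasure X} {Φ : X → H} {m m' : H}
    (h : IsPettisIntegral μ Φ m) (h' : IsPettisIntegral μ Φ m') : m = m' :=
  ext_inner_left ℝ fun w => (h w).2.trans (h' w).2.symm

open Classical in
/-- The Pettis integral `∫ Φ dμ` (with value `0` where it does not exist). -/
def pettisIntegral {H : Type v} [NormedAddCommGroup H] [InnerProductSpace ℝ H]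
    (μ : SignedMeasure X) (Φ : X → H) : H :=
  if h : ∃ m, IsPettisIntegral μ Φ m then h.choose else 0

/-- `ℳ^k(X)`: the finite signed measures `μ` with `H_k ⊆ ℒ₁(μ)`. -/
def IsKernel.embeddable {k : X → X → ℝ} (hk : IsKernel k) : Set (SignedMeasure X) :=
  {μ | ∀ f : hk.Space, (fun x => f x) ∈ signedL1 μ}

/-- The kernel mean embedding `μ ↦ ∫ k(·, x) dμ(x) ∈ H_k`. -/
def IsKernel.meanEmbedding {k : X → X → ℝ} (hk : IsKernel k) (μ : SignedMeasure X) : hk.Space :=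
  pettisIntegral μ hk.featureMap

variable (X) in
/-- `ℳ₀(X)`: the finite signed measures of total mass zero. -/
def zeroMassMeasures : Set (SignedMeasure X) := {μ | μ Set.univ = 0}

variable (X) in
/-- `ℳ₁(X)`: the probability measures, as finite signed measures. -/
def probMeasures : Set (SignedMeasure X) :=
  {μ | ∃ (P : Measure X) (_ : IsProbabilityMeasure P), μ = P.toSignedMeasure}

/-- `k` is a measurable kernel on `X` that is strictly integrally positive definite with respect
to `M ⊆ ℳ^k(X)`: the kernel mean embedding satisfies `‖μ‖²_{H_k} > 0` for all `0 ≠ μ ∈ M`. -/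
def IsStrictlyIntegrallyPosDef (k : X → X → ℝ) (M : Set (SignedMeasure X)) : Prop :=
  Measurable (Function.uncurry k) ∧ ∃ hk : IsKernel k,
    M ⊆ hk.embeddable ∧ ∀ μ ∈ M, μ ≠ 0 → 0 < ‖hk.meanEmbedding μ‖ ^ 2

/-- `k` is a measurable kernel on `X` that is characteristic: the kernel mean embedding is
injective on `ℳ₁(X) ∩ ℳ^k(X)`. -/
def IsCharacteristic (k : X → X → ℝ) : Prop :=
  Measurable (Function.uncurry k) ∧ ∃ hk : IsKernel k,
    Set.InjOn hk.meanEmbedding (probMeasures X ∩ hk.embeddable)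

end Embedding

/-- `Φ_∞⁺`: the Laplace transforms `φ(t) = ∫_{[0,∞)} e^{-xt} dν(x)`, `t ≥ 0`, of the finite Borel
measures `ν` on `[0,∞)` with `ν ≠ 0` and `supp ν ≠ {0}`. -/
def PhiInftyPlus : Set (ℝ≥0 → ℝ) :=
  {φ | ∃ (ν : Measure ℝ≥0) (_ : IsFiniteMeasure ν), ν ≠ 0 ∧ ν.support ≠ {0} ∧
    ∀ t : ℝ≥0, φ t = ∫ x : ℝ≥0, Real.exp (-((x : ℝ) * (t : ℝ))) ∂ν}

end KernelEmbedding

end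

/-! Call `d` of negative type if its quadratic form is nonpositive on weights of sum zero. The
squared distance on the line is of negative type, and negative type survives powers in (0,1] and
integration. Since p ≤ 2, this covers |x - y|^p, then ‖f - g‖^p, then the L^p norm distance itself
(`isNegType_Lp_norm_sub`). By Schoenberg, ‖f - g‖ = ‖ψ f - ψ g‖² for a continuous injection ψ into a
separable Hilbert space, so exp(-s‖f - g‖) is a Gaussian kernel pulled back along ψ.

The squared norm of the mean embedding of P - Q is the energy ∬ k d(P - Q)d(P - Q). For a Gaussian
kernel, zero energy forces equal potentials, hence equal Laplace transforms after Gaussian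
weighting, hence equal characteristic functions (`eq_of_energy_gaussian_eq_zero`). As L^p is Polish,
ψ is a measurable embedding, so P = Q already on L^p. Finally k is the ν-mixture of the kernels
exp(-s‖f - g‖), its energy is the mixture of their nonnegative energies, and ν charges (0,∞). Both
claims thus follow from strictness on all finite signed measures. -/

namespace KernelEmbedding

/-! ### Closure properties of kernels -/

section KernelCalculus

variable {X : Type*} {Y : Type*} {k l : X → X → ℝ}

theorem IsKernel.comp (hk : IsKernel k) (ψ : Y → X) : IsKernel fun x y => k (ψ x) (ψ y) :=
  ⟨fun _ _ => hk.symm _ _, fun n x c => hk.posDef n (fun i => ψ (x i)) c⟩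

theorem isKernel_const {a : ℝ} (ha : 0 ≤ a) : IsKernel fun _ _ : X => a := by
  refine ⟨fun _ _ => rfl, fun n x c => ?_⟩
  have : ∑ i, ∑ j, c i * c j * a = (∑ i, c i) * (∑ i, c i) * a := by
    rw [Finset.sum_mul_sum, Finset.sum_mul]
    exact Finset.sum_congr rfl fun i _ => (Finset.sum_mul _ _ _).symm
  rw [this]
  exact mul_nonneg (mul_self_nonneg _) ha

theorem IsKernel.add (hk : IsKernel k) (hl : IsKernel l) : IsKernel fun x y => k x y + l x y := by
  refine ⟨fun x y => by rw [hk.symm, hl.symm], fun n x c => ?_⟩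
  simp only [mul_add, Finset.sum_add_distrib]
  exact add_nonneg (hk.posDef n x c) (hl.posDef n x c)

theorem IsKernel.posSemidef_of (hk : IsKernel k) {n : ℕ} (x : Fin n → X) :
    (Matrix.of fun i j => k (x i) (x j)).PosSemidef := by
  refine Matrix.PosSemidef.of_dotProduct_mulVec_nonneg ?_ fun c => ?_
  · ext i j
    simp [hk.symm (x i) (x j)]
  · refine (hk.posDef n x c).trans_eq ?_
    simp only [dotProduct, Matrix.mulVec, Finset.mul_sum, Matrix.of_apply, Pi.star_apply,
      star_trivial]
    exact Finset.sum_congr rfl fun i _ => Finset.sum_congr rfl fun j _ => by ring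

/-- The Schur product theorem for kernels. -/
theorem IsKernel.mul (hk : IsKernel k) (hl : IsKernel l) : IsKernel fun x y => k x y * l x y := by
  refine ⟨fun x y => by rw [hk.symm, hl.symm], fun n x c => ?_⟩
  have h := ((hk.posSemidef_of x).hadamard (hl.posSemidef_of x)).dotProduct_mulVec_nonneg c
  refine h.trans_eq ?_
  simp only [dotProduct, Matrix.mulVec, Finset.mul_sum, Matrix.of_apply, Pi.star_apply,
    star_trivial, Matrix.hadamard_apply]
  exact Finset.sum_congr rfl fun i _ => Finset.sum_congr rfl fun j _ => by ring

theorem isKernel_mul_self (f : X → ℝ) : IsKernel fun x y => f x * f y := by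
  refine ⟨fun x y => mul_comm _ _, fun n x c => ?_⟩
  have : ∑ i, ∑ j, c i * c j * (f (x i) * f (x j)) = (∑ i, c i * f (x i)) * ∑ i, c i * f (x i) := by
    rw [Finset.sum_mul_sum]
    exact Finset.sum_congr rfl fun i _ => Finset.sum_congr rfl fun j _ => by ring
  rw [this]
  exact mul_self_nonneg _

theorem isKernel_of_tendsto {K : ℕ → X → X → ℝ} (hK : ∀ m, IsKernel (K m))
    (h : ∀ x y, Filter.Tendsto (fun m => K m x y) Filter.atTop (nhds (k x y))) : IsKernel k := by
  refine ⟨fun x y => tendsto_nhds_unique (h x y) ?_, fun n x c => ?_⟩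
  · simpa only [(hK _).symm x y] using h y x
  · refine ge_of_tendsto' (x := Filter.atTop) (f := fun m =>
      ∑ i, ∑ j, c i * c j * K m (x i) (x j)) ?_ fun m => (hK m).posDef n x c
    exact tendsto_finsetSum _ fun i _ => tendsto_finsetSum _ fun j _ =>
      (h (x i) (x j)).const_mul _

/-- Partial sums of the exponential series are kernels by the Schur product theorem, and kernels are
closed under pointwise limits. -/
theorem IsKernel.exp (hk : IsKernel k) : IsKernel fun x y => Real.exp (k x y) := by
  have hpow : ∀ m : ℕ, IsKernel fun x y => k x y ^ m := by
    intro m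
    induction m with
    | zero => simpa using isKernel_const (X := X) zero_le_one
    | succ m ih => simpa only [pow_succ] using ih.mul hk
  refine isKernel_of_tendsto (K := fun m x y => ∑ i ∈ Finset.range m, k x y ^ i / i.factorial)
    (fun m => ?_) fun x y => ?_
  · induction m with
    | zero => simpa using isKernel_const (X := X) le_rfl
    | succ m ih =>
      simp only [Finset.sum_range_succ]
      refine ih.add ?_
      simp only [div_eq_mul_inv]
      exact (hpow m).mul (isKernel_const (by positivity))
  · rw [Real.exp_eq_exp_ℝ]
    exact (NormedSpace.expSeries_div_hasSum_exp (k x y)).tendsto_sum_nat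

theorem isKernel_integral {T : Type*} [MeasurableSpace T] (ν : Measure T) {K : T → X → X → ℝ}
    (hK : ∀ᵐ t ∂ν, IsKernel (K t)) (hi : ∀ x y, Integrable (fun t => K t x y) ν) :
    IsKernel fun x y => ∫ t, K t x y ∂ν := by
  refine ⟨fun x y => integral_congr_ae ?_, fun n x c => ?_⟩
  · filter_upwards [hK] with t ht using ht.symm x y
  · have : ∑ i, ∑ j, c i * c j * ∫ t, K t (x i) (x j) ∂ν
        = ∫ t, ∑ i, ∑ j, c i * c j * K t (x i) (x j) ∂ν := by
      rw [integral_finsetSum _ fun i _ => integrable_finsetSum _ fun j _ =>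
        (hi _ _).const_mul _]
      refine Finset.sum_congr rfl fun i _ => ?_
      rw [integral_finsetSum _ fun j _ => (hi _ _).const_mul _]
      exact Finset.sum_congr rfl fun j _ => (integral_const_mul _ _).symm
    rw [this]
    exact integral_nonneg_of_ae (hK.mono fun t ht => ht.posDef n x c)

variable {H : Type*} [NormedAddCommGroup H] [InnerProductSpace ℝ H]

theorem isKernel_inner : IsKernel fun x y : H => ⟪x, y⟫ := by
  refine ⟨fun x y => real_inner_comm _ _, fun n x c => ?_⟩
  have : ∑ i, ∑ j, c i * c j * ⟪x i, x j⟫ = ⟪∑ i, c i • x i, ∑ i, c i • x i⟫ := by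
    simp only [sum_inner, inner_sum, real_inner_smul_left, real_inner_smul_right, mul_assoc,
      real_inner_comm (x _) (x _)]
  rw [this]
  exact real_inner_self_nonneg

theorem exp_neg_mul_norm_sub_sq (s : ℝ) (x y : H) :
    Real.exp (-(s * ‖x - y‖ ^ 2)) =
      Real.exp (-(s * ‖x‖ ^ 2)) * Real.exp (-(s * ‖y‖ ^ 2)) * Real.exp (2 * s * ⟪x, y⟫) := by
  rw [← Real.exp_add, ← Real.exp_add, norm_sub_sq_real]
  ring_nf

theorem isKernel_gaussian {s : ℝ} (hs : 0 ≤ s) :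
    IsKernel fun x y : H => Real.exp (-(s * ‖x - y‖ ^ 2)) := by
  simp only [exp_neg_mul_norm_sub_sq]
  exact (isKernel_mul_self _).mul
    ((isKernel_const (a := 2 * s) (by positivity)).mul isKernel_inner).exp

end KernelCalculus

/-! ### Functions of negative type and Schoenberg's embedding -/

section NegativeType

variable {X : Type*} {d : X → X → ℝ}

/-- A distance-like function of negative type (conditionally negative definite). -/
structure IsNegType (d : X → X → ℝ) : Prop where
  symm : ∀ x y, d x y = d y x
  nonneg : ∀ x y, 0 ≤ d x y
  self : ∀ x, d x x = 0
  sum_nonpos : ∀ (n : ℕ) (x : Fin n → X) (c : Fin n → ℝ), ∑ i, c i = 0 →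
    ∑ i, ∑ j, c i * c j * d (x i) (x j) ≤ 0

/-- When the square is expanded, weights of sum zero kill the terms in ‖x i‖² and ‖x j‖², leaving -2
times a Gram form. -/
theorem isNegType_norm_sub_sq {H : Type*} [NormedAddCommGroup H] [InnerProductSpace ℝ H] :
    IsNegType fun x y : H => ‖x - y‖ ^ 2 := by
  refine ⟨fun x y => by rw [norm_sub_rev], fun x y => by positivity, fun x => by simp,
    fun n x c hc => ?_⟩
  have h1 : ∑ i, ∑ j, c i * c j * ‖x i - x j‖ ^ 2
      = (∑ i, c i * ‖x i‖ ^ 2) * (∑ j, c j) + (∑ i, c i) * (∑ j, c j * ‖x j‖ ^ 2)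
        - 2 * ∑ i, ∑ j, c i * c j * ⟪x i, x j⟫ := by
    rw [Finset.sum_mul_sum, Finset.sum_mul_sum, Finset.mul_sum, ← Finset.sum_add_distrib,
      ← Finset.sum_sub_distrib]
    refine Finset.sum_congr rfl fun i _ => ?_
    rw [Finset.mul_sum, ← Finset.sum_add_distrib, ← Finset.sum_sub_distrib]
    refine Finset.sum_congr rfl fun j _ => ?_
    rw [norm_sub_sq_real]
    ring
  have h2 := isKernel_inner.posDef n x c
  rw [h1, hc]
  linarith

/-- The kernel of the Schoenberg embedding with base point `o`. -/
theorem IsNegType.isKernel (hd : IsNegType d) (o : X) :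
    IsKernel fun x y => (d x o + d y o - d x y) / 2 := by
  refine ⟨fun x y => by rw [hd.symm x y]; ring, fun n x c => ?_⟩
  -- The base point is adjoined with the weight that makes the total zero.
  have h := hd.sum_nonpos (n + 1) (Fin.cons o x) (Fin.cons (-∑ i, c i) c)
    (by simp [Fin.sum_univ_succ])
  simp only [Fin.sum_univ_succ, Fin.cons_zero, Fin.cons_succ, hd.self, hd.symm o] at h
  have h1 : ∑ i, ∑ j, c i * c j * ((d (x i) o + d (x j) o - d (x i) (x j)) / 2)
      = ((∑ i, c i * d (x i) o) * (∑ j, c j) + (∑ i, c i) * (∑ j, c j * d (x j) o)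
        - ∑ i, ∑ j, c i * c j * d (x i) (x j)) / 2 := by
    rw [Finset.sum_mul_sum, Finset.sum_mul_sum, ← Finset.sum_add_distrib,
      ← Finset.sum_sub_distrib, Finset.sum_div]
    refine Finset.sum_congr rfl fun i _ => ?_
    rw [← Finset.sum_add_distrib, ← Finset.sum_sub_distrib, Finset.sum_div]
    exact Finset.sum_congr rfl fun j _ => by ring
  have h2 : ∑ j, -(∑ i, c i) * c j * d (x j) o = -(∑ i, c i) * ∑ j, c j * d (x j) o := by
    rw [Finset.mul_sum]
    exact Finset.sum_congr rfl fun j _ => by ring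
  have h3 : ∑ i, c i * -(∑ i, c i) * d (x i) o = -(∑ i, c i) * ∑ j, c j * d (x j) o := by
    rw [Finset.mul_sum]
    exact Finset.sum_congr rfl fun j _ => by ring
  rw [h1]
  rw [Finset.sum_add_distrib, h2, h3] at h
  linarith

theorem IsKernel.norm_featureMap_sub_sq {k : X → X → ℝ} (hk : IsKernel k) (x y : X) :
    ‖hk.featureMap x - hk.featureMap y‖ ^ 2 = k x x - 2 * k x y + k y y := by
  rw [norm_sub_sq_real, ← real_inner_self_eq_norm_sq, ← real_inner_self_eq_norm_sq]
  simp only [hk.inner_featureMap, hk.featureMap_apply, hk.symm y x]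

/-- Schoenberg's embedding of a space of negative type into a Hilbert space. -/
theorem IsNegType.norm_featureMap_sub_sq (hd : IsNegType d) (o x y : X) :
    ‖(hd.isKernel o).featureMap x - (hd.isKernel o).featureMap y‖ ^ 2 = d x y := by
  rw [IsKernel.norm_featureMap_sub_sq]
  simp only [hd.self]
  ring

theorem IsNegType.isKernel_exp (hd : IsNegType d) {s : ℝ} (hs : 0 ≤ s) :
    IsKernel fun x y => Real.exp (-(s * d x y)) := by
  rcases isEmpty_or_nonempty X with hX | ⟨⟨o⟩⟩
  · exact ⟨fun x => hX.elim x, fun n x c => by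
      have : ∀ i, c i = 0 := fun i => hX.elim (x i)
      simp [this]⟩
  · simpa only [hd.norm_featureMap_sub_sq o] using
      (isKernel_gaussian hs).comp (hd.isKernel o).featureMap

/-- The reciprocal is the integral of exp(-(t + d)u) over u > 0, a mixture of kernels. -/
theorem IsNegType.isKernel_inv_add (hd : IsNegType d) {t : ℝ} (ht : 0 < t) :
    IsKernel fun x y => (t + d x y)⁻¹ := by
  have h : ∀ x y, 0 < t + d x y := fun x y => by linarith [hd.nonneg x y]
  have e : (fun x y => (t + d x y)⁻¹)
      = fun x y => ∫ u in Set.Ioi (0 : ℝ), Real.exp (-(t + d x y) * u) := by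
    funext x y
    rw [integral_exp_mul_Ioi (by linarith [h x y])]
    rw [mul_zero, Real.exp_zero, neg_div_neg_eq, one_div]
  rw [e]
  refine isKernel_integral _ ?_ fun x y => integrableOn_exp_mul_Ioi (by linarith [h x y]) _
  filter_upwards [ae_restrict_mem measurableSet_Ioi] with u hu
  have e' : (fun x y => Real.exp (-(t + d x y) * u))
      = fun x y => Real.exp (-(t * u)) * Real.exp (-(u * d x y)) := by
    funext x y
    rw [← Real.exp_add]
    ring_nf
  rw [e']
  exact (isKernel_const (Real.exp_nonneg _)).mul (hd.isKernel_exp (le_of_lt hu))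

/-- Fractional powers of a function of negative type are of negative type. -/
theorem IsNegType.rpow (hd : IsNegType d) {a : ℝ} (ha : 0 < a) (ha1 : a ≤ 1) :
    IsNegType fun x y => d x y ^ a := by
  refine ⟨fun x y => by rw [hd.symm], fun x y => Real.rpow_nonneg (hd.nonneg x y) a,
    fun x => by rw [hd.self, Real.zero_rpow ha.ne'], fun n x c hc => ?_⟩
  rcases eq_or_lt_of_le ha1 with rfl | ha1
  · simpa using hd.sum_nonpos n x c hc
  -- For 0 < a < 1, r^a is the ρ-integral over t > 0 of t^a (1/t - 1/(t + r)). Against weights of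
  -- sum zero the constant 1/t drops out, and what remains is minus a kernel.
  obtain ⟨ρ, hρ⟩ := Real.exists_measure_rpow_eq_integral_rpowIntegrand₀₁ ⟨ha, ha1⟩
  have e : ∑ i, ∑ j, c i * c j * d (x i) (x j) ^ a = ∫ t in Set.Ioi 0,
      ∑ i, ∑ j, c i * c j * Real.rpowIntegrand₀₁ a t (d (x i) (x j)) ∂ρ := by
    rw [integral_finsetSum _ fun i _ => integrable_finsetSum _ fun j _ =>
      (hρ _ (hd.nonneg _ _)).1.const_mul _]
    refine Finset.sum_congr rfl fun i _ => ?_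
    rw [integral_finsetSum _ fun j _ => (hρ _ (hd.nonneg _ _)).1.const_mul _]
    refine Finset.sum_congr rfl fun j _ => ?_
    rw [integral_const_mul, ← (hρ _ (hd.nonneg _ _)).2]
  rw [e]
  refine integral_nonpos_of_ae ?_
  filter_upwards [ae_restrict_mem measurableSet_Ioi] with t ht
  have h := (hd.isKernel_inv_add ht).posDef n x c
  have e' : ∑ i, ∑ j, c i * c j * Real.rpowIntegrand₀₁ a t (d (x i) (x j))
      = t ^ a * t⁻¹ * ((∑ i, c i) * ∑ j, c j)
        - t ^ a * ∑ i, ∑ j, c i * c j * (t + d (x i) (x j))⁻¹ := by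
    rw [Finset.sum_mul_sum, Finset.mul_sum, Finset.mul_sum, ← Finset.sum_sub_distrib]
    refine Finset.sum_congr rfl fun i _ => ?_
    rw [Finset.mul_sum, Finset.mul_sum, ← Finset.sum_sub_distrib]
    refine Finset.sum_congr rfl fun j _ => ?_
    rw [Real.rpowIntegrand₀₁]
    ring
  simp only [e', hc, Pi.zero_apply]
  have := mul_nonneg (Real.rpow_nonneg (le_of_lt ht) a) h
  linarith

theorem isNegType_abs_sub_rpow {p : ℝ} (hp : 0 < p) (hp2 : p ≤ 2) :
    IsNegType fun x y : ℝ => |x - y| ^ p := by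
  have h := (isNegType_norm_sub_sq (H := ℝ)).rpow (a := p / 2) (by linarith) (by linarith)
  convert h using 3 with x y
  rw [← Real.rpow_natCast, ← Real.rpow_mul (norm_nonneg _), Real.norm_eq_abs]
  congr 1
  push_cast
  ring

/-- The p-th power of the distance is an integral over ω of the negative type functions |f ω - g
ω|^p, which uses p ≤ 2; the root 1/p ≤ 1 preserves negative type, which uses p ≥ 1. -/
theorem isNegType_Lp_norm_sub {Ω : Type*} [MeasurableSpace Ω] (ℓ : Measure Ω) (p : ℝ≥0∞)
    [Fact (1 ≤ p)] (hp2 : p ≤ 2) : IsNegType fun f g : Lp ℝ p ℓ => ‖f - g‖ := by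
  have hp1 : 1 ≤ p := Fact.out
  have hpt : p ≠ ∞ := ne_top_of_le_ne_top (by simp) hp2
  have hp0 : p ≠ 0 := (zero_lt_one.trans_le hp1).ne'
  have hq0 : 0 < p.toReal := ENNReal.toReal_pos hp0 hpt
  have hq1 : 1 ≤ p.toReal := by simpa using ENNReal.toReal_mono hpt hp1
  have hq2 : p.toReal ≤ 2 := by simpa using ENNReal.toReal_mono (by simp) hp2
  have hn : ∀ f g : Lp ℝ p ℓ, ‖f - g‖ ^ p.toReal = ∫ ω, |f ω - g ω| ^ p.toReal ∂ℓ := by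
    intro f g
    have h0 : 0 ≤ ∫ ω, ‖(f - g) ω‖ ^ p.toReal ∂ℓ := integral_nonneg fun ω => by positivity
    rw [Lp.norm_def, (Lp.memLp (f - g)).eLpNorm_eq_integral_rpow_norm hp0 hpt,
      ENNReal.toReal_ofReal (by positivity), ← Real.rpow_mul h0, inv_mul_cancel₀ hq0.ne',
      Real.rpow_one]
    refine integral_congr_ae ?_
    filter_upwards [Lp.coeFn_sub f g] with ω hω
    rw [hω, Pi.sub_apply, Real.norm_eq_abs]
  have hi : ∀ f g : Lp ℝ p ℓ, Integrable (fun ω => |f ω - g ω| ^ p.toReal) ℓ := fun f g =>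
    ((Lp.memLp f).sub (Lp.memLp g)).integrable_norm_rpow hp0 hpt
  have hN : IsNegType fun f g : Lp ℝ p ℓ => ‖f - g‖ ^ p.toReal := by
    refine ⟨fun x y => by rw [norm_sub_rev], fun x y => by positivity,
      fun x => by simp [hq0.ne'], fun n x c hc => ?_⟩
    have e : ∑ i, ∑ j, c i * c j * ‖x i - x j‖ ^ p.toReal
        = ∫ ω, ∑ i, ∑ j, c i * c j * |x i ω - x j ω| ^ p.toReal ∂ℓ := by
      rw [integral_finsetSum _ fun i _ => integrable_finsetSum _ fun j _ =>
        (hi _ _).const_mul _]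
      refine Finset.sum_congr rfl fun i _ => ?_
      rw [integral_finsetSum _ fun j _ => (hi _ _).const_mul _]
      refine Finset.sum_congr rfl fun j _ => ?_
      rw [integral_const_mul, hn]
    rw [e]
    exact integral_nonpos fun ω =>
      (isNegType_abs_sub_rpow hq0 hq2).sum_nonpos n (fun i => x i ω) c hc
  have h := hN.rpow (a := p.toReal⁻¹) (by positivity) (inv_le_one_of_one_le₀ hq1)
  convert h using 3 with f g
  rw [← Real.rpow_mul (norm_nonneg _), mul_inv_cancel₀ hq0.ne', Real.rpow_one]

end NegativeType

/-! ### Mean embeddings and energies of bounded continuous kernels -/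

section MeanEmbedding

universe u

variable {X : Type u} [TopologicalSpace X] [SecondCountableTopology X] [MeasurableSpace X]
  [BorelSpace X] {k : X → X → ℝ}

omit [SecondCountableTopology X] [MeasurableSpace X] [BorelSpace X] in
-- The distance between two features is a continuous expression in `k` that vanishes on the
-- diagonal.
theorem IsKernel.continuous_featureMap (hk : IsKernel k) (hc : Continuous (Function.uncurry k)) :
    Continuous hk.featureMap := by
  have hc' : ∀ {f g : X → X}, Continuous f → Continuous g → Continuous fun x => k (f x) (g x) :=
    fun hf hg => hc.comp (hf.prodMk hg)
  refine continuous_iff_continuousAt.mpr fun y => ?_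
  rw [ContinuousAt, tendsto_iff_norm_sub_tendsto_zero]
  have h : Continuous fun x => √(k x x - 2 * k x y + k y y) :=
    (((hc' continuous_id continuous_id).sub
      ((hc' continuous_id continuous_const).const_mul 2)).add continuous_const).sqrt
  have h' := h.tendsto y
  have e : k y y - 2 * k y y + k y y = 0 := by ring
  rw [e, Real.sqrt_zero] at h'
  refine h'.congr fun x => ?_
  rw [← hk.norm_featureMap_sub_sq, Real.sqrt_sq (norm_nonneg _)]

omit [TopologicalSpace X] [SecondCountableTopology X] [MeasurableSpace X] [BorelSpace X] in
theorem IsKernel.norm_featureMap_sq (hk : IsKernel k) (x : X) : ‖hk.featureMap x‖ ^ 2 = k x x := by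
  rw [← real_inner_self_eq_norm_sq, hk.inner_featureMap, hk.featureMap_apply]

/-- A kernel that is continuous and bounded on the diagonal. -/
structure IsBoundedContinuousKernel (k : X → X → ℝ) : Prop where
  isKernel : IsKernel k
  continuous : Continuous (Function.uncurry k)
  bounded : ∃ B : ℝ, ∀ x, k x x ≤ B

namespace IsBoundedContinuousKernel

variable (h : IsBoundedContinuousKernel k)
include h

omit [MeasurableSpace X] [BorelSpace X] [SecondCountableTopology X] in
theorem exists_norm_featureMap_le : ∃ B : ℝ, ∀ x, ‖h.isKernel.featureMap x‖ ≤ B := by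
  obtain ⟨B, hB⟩ := h.bounded
  refine ⟨√B, fun x => Real.le_sqrt_of_sq_le ?_⟩
  rw [h.isKernel.norm_featureMap_sq]
  exact hB x

theorem integrable_featureMap (P : Measure X) [IsFiniteMeasure P] :
    Integrable h.isKernel.featureMap P := by
  obtain ⟨B, hB⟩ := h.exists_norm_featureMap_le
  exact Integrable.of_bound
    (h.isKernel.continuous_featureMap h.continuous).aestronglyMeasurable B (.of_forall hB)

theorem mem_signedL1 (μ : SignedMeasure X) (w : h.isKernel.Space) :
    (fun x => inner ℝ w (h.isKernel.featureMap x)) ∈ signedL1 μ := by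
  have hc := h.isKernel.continuous_featureMap h.continuous
  refine ⟨(continuous_const.inner hc).measurable, ?_⟩
  have : IsFiniteMeasure μ.totalVariation := by
    rw [SignedMeasure.totalVariation]; infer_instance
  exact (h.integrable_featureMap _).const_inner w

theorem mem_embeddable (μ : SignedMeasure X) : μ ∈ h.isKernel.embeddable := fun f => by
  simpa only [h.isKernel.inner_featureMap f] using h.mem_signedL1 μ f

/-- A bounded continuous feature map is Bochner integrable, and Bochner integrals commute with inner
products. -/
theorem isPettisIntegral (P Q : Measure X) [IsFiniteMeasure P] [IsFiniteMeasure Q] :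
    IsPettisIntegral (P.toSignedMeasure - Q.toSignedMeasure) h.isKernel.featureMap
      (∫ x, h.isKernel.featureMap x ∂P - ∫ x, h.isKernel.featureMap x ∂Q) := by
  refine fun w => ⟨h.mem_signedL1 _ w, ?_⟩
  have hP := (h.integrable_featureMap P).const_inner (𝕜 := ℝ) w
  have hQ := (h.integrable_featureMap Q).const_inner (𝕜 := ℝ) w
  rw [VectorMeasure.integral_sub_vectorMeasure (by simpa [VectorMeasure.Integrable] using hP)
    (by simpa [VectorMeasure.Integrable] using hQ),
    VectorMeasure.integral_toSignedMeasure, VectorMeasure.integral_toSignedMeasure,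
    integral_inner (h.integrable_featureMap P), integral_inner (h.integrable_featureMap Q),
    inner_sub_right]

theorem meanEmbedding_eq (P Q : Measure X) [IsFiniteMeasure P] [IsFiniteMeasure Q] :
    h.isKernel.meanEmbedding (P.toSignedMeasure - Q.toSignedMeasure) =
      ∫ x, h.isKernel.featureMap x ∂P - ∫ x, h.isKernel.featureMap x ∂Q := by
  have hm := h.isPettisIntegral P Q
  rw [IsKernel.meanEmbedding, pettisIntegral, dif_pos ⟨_, hm⟩]
  exact IsPettisIntegral.unique (Classical.choose_spec _) hm

theorem integrable_prod (P Q : Measure X) [IsFiniteMeasure P] [IsFiniteMeasure Q] :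
    Integrable (fun z : X × X => k z.1 z.2) (P.prod Q) := by
  obtain ⟨B, hB⟩ := h.exists_norm_featureMap_le
  refine Integrable.of_bound h.continuous.aestronglyMeasurable (B * B) (.of_forall fun z => ?_)
  rw [← h.isKernel.featureMap_apply, ← h.isKernel.inner_featureMap]
  exact (norm_inner_le_norm _ _).trans
    (mul_le_mul (hB _) (hB _) (norm_nonneg _) ((norm_nonneg _).trans (hB z.1)))

/-- Fubini and the reproducing property; this turns norms in `H_k` into energies. -/
theorem inner_integral_featureMap (P Q : Measure X) [IsFiniteMeasure P] [IsFiniteMeasure Q] :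
    ⟪∫ x, h.isKernel.featureMap x ∂P, ∫ x, h.isKernel.featureMap x ∂Q⟫ =
      ∫ z, k z.1 z.2 ∂(P.prod Q) := by
  rw [integral_prod _ (h.integrable_prod P Q), real_inner_comm,
    ← integral_inner (h.integrable_featureMap P)]
  refine integral_congr_ae (.of_forall fun x => ?_)
  dsimp only
  rw [real_inner_comm, ← integral_inner (h.integrable_featureMap Q)]
  refine integral_congr_ae (.of_forall fun y => ?_)
  dsimp only
  rw [h.isKernel.inner_featureMap, h.isKernel.featureMap_apply, h.isKernel.symm]

end IsBoundedContinuousKernel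

omit [TopologicalSpace X] [SecondCountableTopology X] [BorelSpace X] in
variable (k) in
/-- The energy `∬ k d(P - Q) d(P - Q)`. -/
noncomputable def energy (P Q : Measure X) : ℝ :=
  ∫ z, k z.1 z.2 ∂(P.prod P) - 2 * ∫ z, k z.1 z.2 ∂(P.prod Q) + ∫ z, k z.1 z.2 ∂(Q.prod Q)

theorem IsBoundedContinuousKernel.norm_sub_sq (h : IsBoundedContinuousKernel k)
    (P Q : Measure X) [IsFiniteMeasure P] [IsFiniteMeasure Q] :
    ‖∫ x, h.isKernel.featureMap x ∂P - ∫ x, h.isKernel.featureMap x ∂Q‖ ^ 2 = energy k P Q := by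
  rw [norm_sub_sq_real, ← real_inner_self_eq_norm_sq, ← real_inner_self_eq_norm_sq,
    h.inner_integral_featureMap, h.inner_integral_featureMap, h.inner_integral_featureMap, energy]

theorem IsBoundedContinuousKernel.energy_nonneg (h : IsBoundedContinuousKernel k)
    (P Q : Measure X) [IsFiniteMeasure P] [IsFiniteMeasure Q] : 0 ≤ energy k P Q := by
  rw [← h.norm_sub_sq]
  positivity

/-- If the energy of `P - Q` vanishes, then `P` and `Q` have the same potential. -/
theorem IsBoundedContinuousKernel.integral_eq_of_energy_eq_zero (h : IsBoundedContinuousKernel k)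
    {P Q : Measure X} [IsFiniteMeasure P] [IsFiniteMeasure Q] (h0 : energy k P Q = 0) (a : X) :
    ∫ x, k x a ∂P = ∫ x, k x a ∂Q := by
  rw [← h.norm_sub_sq, sq_eq_zero_iff, norm_eq_zero, sub_eq_zero] at h0
  have e : ∀ ρ : Measure X, IsFiniteMeasure ρ →
      ∫ x, k x a ∂ρ = ⟪h.isKernel.featureMap a, ∫ x, h.isKernel.featureMap x ∂ρ⟫ := by
    intro ρ _
    rw [← integral_inner (h.integrable_featureMap ρ)]
    refine integral_congr_ae (.of_forall fun x => ?_)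
    dsimp only
    rw [h.isKernel.inner_featureMap, h.isKernel.featureMap_apply]
  rw [e P inferInstance, e Q inferInstance, h0]

end MeanEmbedding

/-! ### Strictness of the Gaussian kernel on a separable Hilbert space -/

section Gaussian

variable {H : Type*} [NormedAddCommGroup H] [InnerProductSpace ℝ H]

theorem isBoundedContinuousKernel_gaussian {s : ℝ} (hs : 0 ≤ s) :
    IsBoundedContinuousKernel fun x y : H => Real.exp (-(s * ‖x - y‖ ^ 2)) :=
  ⟨isKernel_gaussian hs, by simp only [Function.uncurry_def]; fun_prop, 1, fun x => by simp⟩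

variable [CompleteSpace H] [SecondCountableTopology H] [MeasurableSpace H] [BorelSpace H]

open ProbabilityTheory in
/-- Finite measures with finite, equal Laplace transforms coincide. -/
theorem ext_of_integral_exp_inner {P Q : Measure H} [IsFiniteMeasure P] [IsFiniteMeasure Q]
    (hi : ∀ a : H, Integrable (fun x => Real.exp ⟪x, a⟫) P)
    (h : ∀ a : H, ∫ x, Real.exp ⟪x, a⟫ ∂P = ∫ x, Real.exp ⟪x, a⟫ ∂Q) : P = Q := by
  refine Measure.ext_of_charFun (funext fun a => ?_)
  have hm : mgf (fun x => ⟪x, a⟫) P = mgf (fun x => ⟪x, a⟫) Q := by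
    funext t
    simpa only [mgf, inner_smul_right] using h (t • a)
  -- The transforms at 0 are the total masses.
  have h0 : P = 0 ↔ Q = 0 := by
    have h0 := h 0
    simp only [inner_zero_right, Real.exp_zero, integral_const, smul_eq_mul, mul_one] at h0
    rw [← Measure.measure_univ_eq_zero, ← Measure.measure_univ_eq_zero (μ := Q),
      ← measureReal_eq_zero_iff, h0, measureReal_eq_zero_iff]
  have hI : integrableExpSet (fun x => ⟪x, a⟫) P = Set.univ := by
    refine Set.eq_univ_of_forall fun t => ?_
    simpa only [integrableExpSet, Set.mem_ofPred_eq, inner_smul_right] using hi (t • a)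
  -- The moment generating functions are finite on all of ℝ, so their equality continues
  -- analytically to the imaginary unit, where they become characteristic functions.
  have hc := eqOn_complexMGF_of_mgf' hm h0 (x := Complex.I) (by simp [hI])
  simp only [complexMGF] at hc
  simp only [charFun_apply]
  simpa only [mul_comm Complex.I] using hc

/-- The Gaussian kernel of a separable Hilbert space is strictly integrally positive definite. -/
theorem eq_of_energy_gaussian_eq_zero {s : ℝ} (hs : 0 < s) {P Q : Measure H} [IsFiniteMeasure P]
    [IsFiniteMeasure Q]
    (h : energy (fun x y : H => Real.exp (-(s * ‖x - y‖ ^ 2))) P Q = 0) : P = Q := by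
  have hpot := (isBoundedContinuousKernel_gaussian hs.le).integral_eq_of_energy_eq_zero h
  -- This weight makes every exponential x ↦ exp⟪x, a⟫ integrable.
  let w : H → ℝ≥0 := fun x => ⟨Real.exp (-(s * ‖x‖ ^ 2)), Real.exp_nonneg _⟩
  have hw : Measurable w := by
    refine Measurable.subtype_mk ?_
    fun_prop
  have hw1 : ∀ x, w x ≤ 1 := fun x => by
    rw [← NNReal.coe_le_coe]
    exact Real.exp_le_one_iff.mpr (by have := sq_nonneg ‖x‖; nlinarith)
  have key : ∀ R : Measure H, IsFiniteMeasure R →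
      IsFiniteMeasure (R.withDensity fun x => (w x : ℝ≥0∞)) := fun R _ =>
    isFiniteMeasure_withDensity (ne_top_of_le_ne_top (measure_ne_top R Set.univ)
      ((lintegral_mono fun x => ENNReal.coe_le_one_iff.mpr (hw1 x)).trans_eq (by simp)))
  have := key P inferInstance
  have := key Q inferInstance
  -- Completing the square: the weighted exponential is a constant times the Gaussian centred at
  -- a/(2s), so its integral is a multiple of the potential there.
  have hexp : ∀ x a : H, w x • Real.exp ⟪x, a⟫ =
      Real.exp (s * ‖(2 * s)⁻¹ • a‖ ^ 2) *
        Real.exp (-(s * ‖x - (2 * s)⁻¹ • a‖ ^ 2)) := fun x a => by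
    rw [exp_neg_mul_norm_sub_sq, real_inner_smul_right, mul_inv_cancel_left₀ (by positivity)]
    change Real.exp (-(s * ‖x‖ ^ 2)) * Real.exp ⟪x, a⟫ = _
    rw [mul_left_comm, mul_assoc]
    congr 1
    rw [mul_left_comm, ← mul_assoc, ← Real.exp_add, add_neg_cancel, Real.exp_zero, one_mul]
  have hPQ : (P.withDensity fun x => (w x : ℝ≥0∞)) = Q.withDensity fun x => (w x : ℝ≥0∞) := by
    refine ext_of_integral_exp_inner (fun a => ?_) fun a => ?_
    · rw [integrable_withDensity_iff_integrable_smul hw]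
      simp only [hexp]
      refine Integrable.const_mul (Integrable.of_bound (C := 1) (by fun_prop)
        (.of_forall fun x => ?_)) _
      rw [Real.norm_eq_abs, Real.abs_exp]
      exact Real.exp_le_one_iff.mpr (by have := sq_nonneg ‖x - (2 * s)⁻¹ • a‖; nlinarith)
    · rw [integral_withDensity_eq_integral_smul hw, integral_withDensity_eq_integral_smul hw]
      simp only [hexp, integral_const_mul, hpot]
  have hw' : Measurable fun x => (w x : ℝ≥0∞) := hw.coe_nnreal_ennreal
  have hne : ∀ x, (w x : ℝ≥0∞) ≠ 0 := fun x => by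
    rw [ENNReal.coe_ne_zero, ← NNReal.coe_ne_zero]
    exact (Real.exp_pos _).ne'
  -- The density is positive and finite, so it can be divided out.
  rw [← withDensity_inv_same hw' (μ := P) (.of_forall hne) (.of_forall fun x => ENNReal.coe_ne_top),
    hPQ, withDensity_inv_same hw' (.of_forall hne) (.of_forall fun x => ENNReal.coe_ne_top)]

end Gaussian

/-! ### Transfer to Polish spaces and mixtures -/

section StrictPositivity

universe u

variable {X : Type u} {k : X → X → ℝ}

/-- The features of a countable dense set span a dense subspace: an element orthogonal to them
vanishes on a dense set, hence everywhere by continuity. -/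
theorem IsKernel.separableSpace_space [TopologicalSpace X] [TopologicalSpace.SeparableSpace X]
    (hk : IsKernel k) (hc : Continuous hk.featureMap) :
    TopologicalSpace.SeparableSpace hk.Space := by
  obtain ⟨t, htc, htd⟩ := TopologicalSpace.exists_countable_dense X
  let S : Submodule ℝ hk.Space := Submodule.span ℝ (hk.featureMap '' t)
  have hS : S.topologicalClosure = ⊤ := by
    rw [Submodule.topologicalClosure_eq_top_iff, Submodule.eq_bot_iff]
    intro f hf
    have h0 : Set.EqOn (fun x => ⟪f, hk.featureMap x⟫) 0 t := fun x hx =>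
      (Submodule.mem_orthogonal' _ _).mp hf _ (Submodule.subset_span ⟨x, hx, rfl⟩)
    have h1 := Continuous.ext_on htd (continuous_const.inner hc) continuous_zero h0
    refine RKHS.ext fun x => ?_
    rw [← hk.inner_featureMap, RKHS.coe_zero]
    exact congrFun h1 x
  have hsep : TopologicalSpace.IsSeparable (S.topologicalClosure : Set hk.Space) :=
    ((htc.image _).isSeparable.span (R := ℝ)).closure
  rw [hS, Submodule.top_coe] at hsep
  exact TopologicalSpace.isSeparable_univ_iff.mp hsep

theorem energy_map [MeasurableSpace X] {Y : Type*} [MeasurableSpace Y] {k : Y → Y → ℝ}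
    {ψ : X → Y} (hψ : MeasurableEmbedding ψ) (P Q : Measure X) [IsFiniteMeasure P]
    [IsFiniteMeasure Q] :
    energy k (P.map ψ) (Q.map ψ) = energy (fun x y => k (ψ x) (ψ y)) P Q := by
  have e : ∀ A B : Measure X, IsFiniteMeasure A → IsFiniteMeasure B →
      ∫ z, k z.1 z.2 ∂((A.map ψ).prod (B.map ψ)) = ∫ z, k (ψ z.1) (ψ z.2) ∂(A.prod B) := by
    intro A B _ _
    rw [Measure.map_prod_map _ _ hψ.measurable hψ.measurable,
      (hψ.prodMap hψ).integral_map]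
    rfl
  simp only [energy, e _ _ ‹IsFiniteMeasure P› ‹IsFiniteMeasure P›,
    e _ _ ‹IsFiniteMeasure P› ‹IsFiniteMeasure Q›, e _ _ ‹IsFiniteMeasure Q› ‹IsFiniteMeasure Q›]

variable [TopologicalSpace X] [PolishSpace X] [MeasurableSpace X] [BorelSpace X] {d : X → X → ℝ}

/-- On a Polish space, the kernel `exp (-s d)` of a continuous semimetric `d` of negative type is
strictly integrally positive definite. -/
theorem IsNegType.eq_of_energy_exp_eq_zero (hd : IsNegType d)
    (hc : Continuous (Function.uncurry d)) (hsep : ∀ x y, d x y = 0 → x = y) {s : ℝ} (hs : 0 < s)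
    {P Q : Measure X} [IsFiniteMeasure P] [IsFiniteMeasure Q]
    (h : energy (fun x y => Real.exp (-(s * d x y))) P Q = 0) : P = Q := by
  rcases isEmpty_or_nonempty X with hX | ⟨⟨o⟩⟩
  · exact Subsingleton.elim _ _
  have hk := hd.isKernel o
  have hcd : ∀ {Z : Type u} [TopologicalSpace Z] {f g : Z → X}, Continuous f → Continuous g →
      Continuous fun z => d (f z) (g z) := fun hf hg => hc.comp (hf.prodMk hg)
  have hψ : Continuous hk.featureMap := hk.continuous_featureMap <|
    (((hcd continuous_fst continuous_const).add (hcd continuous_snd continuous_const)).sub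
      (hcd continuous_fst continuous_snd)).div_const 2
  have hn : ∀ x y, ‖hk.featureMap x - hk.featureMap y‖ ^ 2 = d x y := hd.norm_featureMap_sub_sq o
  have hinj : Function.Injective hk.featureMap := fun x y hxy => hsep x y <| by
    rw [← hn, hxy, sub_self, norm_zero, zero_pow two_ne_zero]
  have := hk.separableSpace_space hψ
  have : SecondCountableTopology hk.Space := UniformSpace.secondCountable_of_separable _
  borelize hk.Space
  -- Lusin–Souslin: a continuous injection of a Polish space maps Borel sets to Borel sets here, so
  -- a measure is recovered from its pushforward.
  have hemb : MeasurableEmbedding hk.featureMap := hψ.measurableEmbedding hinj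
  simp only [← hn] at h
  rw [← energy_map (k := fun a b : hk.Space => Real.exp (-(s * ‖a - b‖ ^ 2))) hemb] at h
  have hPQ := eq_of_energy_gaussian_eq_zero hs h
  rw [← hemb.comap_map P, hPQ, hemb.comap_map]

variable {ν : Measure ℝ≥0} [IsFiniteMeasure ν]

omit [TopologicalSpace X] [PolishSpace X] [MeasurableSpace X] [BorelSpace X] in
theorem IsNegType.norm_exp_neg_mul_le_one (hd : IsNegType d) (s : ℝ≥0) (x y : X) :
    ‖Real.exp (-((s : ℝ) * d x y))‖ ≤ 1 := by
  rw [Real.norm_eq_abs, Real.abs_exp]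
  exact Real.exp_le_one_iff.mpr (neg_nonpos.mpr (mul_nonneg s.2 (hd.nonneg x y)))

omit [PolishSpace X] [MeasurableSpace X] [BorelSpace X] in
theorem IsNegType.isBoundedContinuousKernel_exp (hd : IsNegType d)
    (hc : Continuous (Function.uncurry d)) {s : ℝ} (hs : 0 ≤ s) :
    IsBoundedContinuousKernel fun x y => Real.exp (-(s * d x y)) :=
  ⟨hd.isKernel_exp hs, Real.continuous_exp.comp (hc.const_mul s).neg, 1, fun x => by simp [hd.self]⟩

omit [PolishSpace X] [MeasurableSpace X] [BorelSpace X] in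
theorem IsNegType.isBoundedContinuousKernel_laplace [FirstCountableTopology X] (hd : IsNegType d)
    (hc : Continuous (Function.uncurry d)) :
    IsBoundedContinuousKernel fun x y => ∫ s : ℝ≥0, Real.exp (-((s : ℝ) * d x y)) ∂ν := by
  have hm : ∀ x y, AEStronglyMeasurable (fun s : ℝ≥0 => Real.exp (-((s : ℝ) * d x y))) ν :=
    fun x y => by fun_prop
  refine ⟨isKernel_integral ν (.of_forall fun s => hd.isKernel_exp s.2) fun x y =>
    Integrable.of_bound (hm x y) 1 (.of_forall fun s => hd.norm_exp_neg_mul_le_one s x y), ?_,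
    ∫ _ : ℝ≥0, (1 : ℝ) ∂ν, fun x => by simp [hd.self]⟩
  exact continuous_of_dominated (fun z => hm z.1 z.2)
    (fun z => .of_forall fun s => hd.norm_exp_neg_mul_le_one s z.1 z.2) (integrable_const 1)
    (.of_forall fun s => Real.continuous_exp.comp (hc.const_mul (s : ℝ)).neg)

/-- The energy of a mixture of exponential kernels is the mixture of the energies. -/
theorem IsNegType.energy_laplace (hd : IsNegType d) (hc : Continuous (Function.uncurry d))
    (P Q : Measure X) [IsFiniteMeasure P] [IsFiniteMeasure Q] :
    Integrable (fun s : ℝ≥0 => energy (fun x y => Real.exp (-((s : ℝ) * d x y))) P Q) ν ∧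
    energy (fun x y => ∫ s : ℝ≥0, Real.exp (-((s : ℝ) * d x y)) ∂ν) P Q =
      ∫ s : ℝ≥0, energy (fun x y => Real.exp (-((s : ℝ) * d x y))) P Q ∂ν := by
  have hi : ∀ A B : Measure X, IsFiniteMeasure A → IsFiniteMeasure B → Integrable
      (Function.uncurry fun (z : X × X) (s : ℝ≥0) => Real.exp (-((s : ℝ) * d z.1 z.2)))
      ((A.prod B).prod ν) := by
    intro A B _ _
    refine Integrable.of_bound (Continuous.aestronglyMeasurable ?_) 1
      (.of_forall fun z => hd.norm_exp_neg_mul_le_one z.2 z.1.1 z.1.2)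
    exact Real.continuous_exp.comp
      ((NNReal.continuous_coe.comp continuous_snd).mul (hc.comp continuous_fst)).neg
  have hj : ∀ A B : Measure X, IsFiniteMeasure A → IsFiniteMeasure B → Integrable
      (fun s : ℝ≥0 => ∫ z : X × X, Real.exp (-((s : ℝ) * d z.1 z.2)) ∂(A.prod B)) ν :=
    fun A B hA hB => (hi A B hA hB).integral_prod_right
  have hPP := hj P P inferInstance inferInstance
  have hPQ := (hj P Q inferInstance inferInstance).const_mul 2
  have hQQ := hj Q Q inferInstance inferInstance
  have hD : Integrable (fun s : ℝ≥0 => ∫ z, Real.exp (-((s : ℝ) * d z.1 z.2)) ∂(P.prod P) -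
      2 * ∫ z, Real.exp (-((s : ℝ) * d z.1 z.2)) ∂(P.prod Q)) ν := hPP.sub hPQ
  refine ⟨hD.add hQQ, ?_⟩
  simp only [energy]
  rw [integral_add hD hQQ, integral_sub hPP hPQ, integral_const_mul,
    integral_integral_swap (hi P P inferInstance inferInstance),
    integral_integral_swap (hi P Q inferInstance inferInstance),
    integral_integral_swap (hi Q Q inferInstance inferInstance)]

/-- A vanishing integral of nonnegative energies vanishes for ν-almost every s. Since ν charges
(0,∞), some s > 0 has zero energy, and that one suffices. -/
theorem IsNegType.eq_of_energy_laplace_eq_zero (hd : IsNegType d)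
    (hc : Continuous (Function.uncurry d)) (hsep : ∀ x y, d x y = 0 → x = y)
    (hν : ν (Set.Ioi 0) ≠ 0) {P Q : Measure X} [IsFiniteMeasure P] [IsFiniteMeasure Q]
    (h : energy (fun x y => ∫ s : ℝ≥0, Real.exp (-((s : ℝ) * d x y)) ∂ν) P Q = 0) : P = Q := by
  obtain ⟨hi, he⟩ := hd.energy_laplace (ν := ν) hc P Q
  rw [he, integral_eq_zero_iff_of_nonneg
    (fun s => (hd.isBoundedContinuousKernel_exp hc s.2).energy_nonneg P Q) hi] at h
  have hfr : ∃ᵐ s : ℝ≥0 ∂ν, s ∈ Set.Ioi 0 := frequently_ae_mem_iff.mpr hν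
  obtain ⟨s, hs, hs0⟩ := (hfr.and_eventually h).exists
  exact hd.eq_of_energy_exp_eq_zero hc hsep (s := (s : ℝ)) hs hs0

omit [PolishSpace X] in
theorem IsBoundedContinuousKernel.isStrictlyIntegrallyPosDef [SecondCountableTopology X]
    (hk : IsBoundedContinuousKernel k)
    (h : ∀ P Q : Measure X, IsFiniteMeasure P → IsFiniteMeasure Q → energy k P Q = 0 → P = Q)
    (M : Set (SignedMeasure X)) : IsStrictlyIntegrallyPosDef k M := by
  refine ⟨hk.continuous.measurable, hk.isKernel, fun μ _ => hk.mem_embeddable μ,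
    fun μ _ hμ => ?_⟩
  -- The Jordan parts of μ serve as P and Q; if they agree, then μ = 0.
  have hj := μ.toSignedMeasure_toJordanDecomposition
  rw [JordanDecomposition.toSignedMeasure] at hj
  rw [← hj, hk.meanEmbedding_eq, hk.norm_sub_sq]
  refine (hk.energy_nonneg _ _).lt_of_ne fun h0 => hμ ?_
  have e := h _ _ inferInstance inferInstance h0.symm
  rw [← hj]
  simp only [e, sub_self]

omit [PolishSpace X] in
theorem IsBoundedContinuousKernel.isCharacteristic [SecondCountableTopology X]
    (hk : IsBoundedContinuousKernel k)
    (h : ∀ P Q : Measure X, IsFiniteMeasure P → IsFiniteMeasure Q → energy k P Q = 0 → P = Q) :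
    IsCharacteristic k := by
  refine ⟨hk.continuous.measurable, hk.isKernel, ?_⟩
  rintro _ ⟨⟨P, hP, rfl⟩, -⟩ _ ⟨⟨Q, hQ, rfl⟩, -⟩ hPQ
  -- The embedding formula is for differences, so a single measure is written as R - 0.
  have e : ∀ (R : Measure X) [IsFiniteMeasure R], R.toSignedMeasure =
      R.toSignedMeasure - (0 : Measure X).toSignedMeasure := fun R _ => by simp
  rw [e P, e Q, hk.meanEmbedding_eq, hk.meanEmbedding_eq] at hPQ
  have h0 : energy k P Q = 0 := by
    rw [← hk.norm_sub_sq, sub_left_inj.mp hPQ, sub_self, norm_zero, zero_pow two_ne_zero]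
  obtain rfl := h P Q inferInstance inferInstance h0
  rfl

end StrictPositivity

/-- Otherwise the support lies in {0}: it is either empty, so that ν = 0, or equal to {0}. -/
theorem measure_Ioi_ne_zero_of_support_ne {ν : Measure ℝ≥0} (h0 : ν ≠ 0)
    (hs : ν.support ≠ {0}) : ν (Set.Ioi 0) ≠ 0 := by
  intro h
  have hsub : ν.support ⊆ {0} := Measure.support_subset_of_isClosed isClosed_singleton <| by
    rw [mem_ae_iff]
    convert h using 2
    ext x
    simp [pos_iff_ne_zero]
  rcases Set.subset_singleton_iff_eq.mp hsub with h' | h'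
  · exact h0 (Measure.support_eq_empty_iff.mp h')
  · exact hs h'

end KernelEmbedding

theorem mainTheorem8 {Ω : Type*} [MeasurableSpace Ω] (ℓ : Measure Ω) [SigmaFinite ℓ]
    (p : ℝ≥0∞) [Fact (1 ≤ p)] (hp1 : 1 < p) (hp2 : p ≤ 2)
    [TopologicalSpace.SeparableSpace (Lp ℝ p ℓ)]
    [MeasurableSpace (Lp ℝ p ℓ)] [BorelSpace (Lp ℝ p ℓ)]
    (φ : ℝ≥0 → ℝ) (hφ : φ ∈ KernelEmbedding.PhiInftyPlus) :
    KernelEmbedding.IsCharacteristic (fun f g : Lp ℝ p ℓ => φ ‖f - g‖₊) ∧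
    KernelEmbedding.IsStrictlyIntegrallyPosDef (fun f g : Lp ℝ p ℓ => φ ‖f - g‖₊)
      (KernelEmbedding.zeroMassMeasures (Lp ℝ p ℓ)) := by
  obtain ⟨ν, _, h0, hs, hν⟩ := hφ
  simp only [hν, coe_nnnorm]
  -- With completeness this makes L^p Polish.
  have : SecondCountableTopology (Lp ℝ p ℓ) := UniformSpace.secondCountable_of_separable _
  have hd := KernelEmbedding.isNegType_Lp_norm_sub ℓ p hp2
  have hc : Continuous (Function.uncurry fun f g : Lp ℝ p ℓ => ‖f - g‖) :=
    (continuous_fst.sub continuous_snd).norm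
  have hk := hd.isBoundedContinuousKernel_laplace (ν := ν) hc
  have hE := fun (P Q : Measure (Lp ℝ p ℓ)) (_ : IsFiniteMeasure P) (_ : IsFiniteMeasure Q) =>
    hd.eq_of_energy_laplace_eq_zero (P := P) (Q := Q) hc
      (fun f g h => sub_eq_zero.mp (norm_eq_zero.mp h))
      (KernelEmbedding.measure_Ioi_ne_zero_of_support_ne h0 hs)
  exact ⟨hk.isCharacteristic hE, hk.isStrictlyIntegrallyPosDef hE _⟩
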